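/- A Bell functional with finite input sets $\mathbf X,\mathbf Y$ and finite output sets $\mathbf A,\mathbf B$ (for Alice and Bob respectively) is a family of real numbers $B=(B_{a,b,x,y})$. It acts on families $P=(P(a,b|x,y))$ of probability distributions by $\langle B,P\rangle=\sum_{a,b,x,y}B_{a,b,x,y}P(a,b|x,y)$. Put $$\omega(B)=\sup_{P\in\mathcal L}|\langle B,P\rangle|,\qquad \omega^*(B)=\sup_{P\in\mathcal Q}|\langle B,P\rangle|.$$ Here $\mathcal L$ is the set of all $P$ of the form $P(a,b|x,y)=\int_\Omega P_\omega(a|x)Q_\omega(b|y)\,d\mathbb P(\omega)$ with $(\Omega,\Sigma,\mathbb P)$ a probability space, $P_\omega(a|x),Q_\omega(b|y)\ge 0$ measurable in $\omega$, $\sum_aP_\omega(a|x)=1$ and $\sum_bQ_\omega(b|y)=1$. The set $\mathcal Q$ consists of all $P$ of the form $P(a,b|x,y)=\mathrm{tr}\big((E_x^a\otimes F_y^b)\rho\big)$, where $\rho$ is a density operator on a tensor product $H_1\otimes H_2$ of two complex Hilbert spaces and $(E_x^a)_a$, $(F_y^b)_b$ are, for all $x$, $y$, POVMs on $H_1$ and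 $H_2$ respectively. **Corollary.** There are universal constants $c\in\mathbb N$ and $D'>0$ such that for every integer $n\ge 2$ there is a Bell functional $B$ with $cn^{12}$ inputs and $2n^2$ outputs for Alice, and $cn^{14}$ inputs and $2$ outputs for Bob, for which $\omega(B)>0$ and $$\frac{\omega^*(B)}{\omega(B)}\ \ge\ D'\,\frac{\sqrt n}{\log n}.$$ -/

import Mathlib

open MeasureTheory
open scoped TensorProduct InnerProductSpace

/-- The coefficients `B x y a b` of a linear functional on the tables `P(a, b | x, y)`, where
`x, y` are the inputs and `a, b` the outputs of Alice and Bob. -/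
abbrev BellFunctional (X Y A B : Type) : Type := X → Y → A → B → ℝ

/-- A table `P x y a b`, to be read as `P(a, b | x, y)`. -/
abbrev Behaviour (X Y A B : Type) : Type := X → Y → A → B → ℝ

section Bell

variable {X Y A B : Type}

/-- `⟨F, P⟩ = ∑ F(a, b, x, y) P(a, b | x, y)`. -/
def BellFunctional.pairing [Fintype X] [Fintype Y] [Fintype A] [Fintype B]
    (F : BellFunctional X Y A B) (P : Behaviour X Y A B) : ℝ :=
  ∑ x, ∑ y, ∑ a, ∑ b, F x y a b * P x y a b

/-- For each pair of inputs, `P` is a probability distribution on the pairs of outputs. -/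
def Behaviour.IsDistribution [Fintype A] [Fintype B] (P : Behaviour X Y A B) : Prop :=
  (∀ x y a b, 0 ≤ P x y a b) ∧ ∀ x y, ∑ a, ∑ b, P x y a b = 1

/-- The classical bipartite probability distributions: those produced by local responses
`p ω x a = P_ω(a | x)` and `q ω y b = Q_ω(b | y)` depending on shared randomness `ω`. -/
def classicalSet (X Y A B : Type) [Fintype A] [Fintype B] : Set (Behaviour X Y A B) :=
  {P | P.IsDistribution ∧
    ∃ (Ω : Type) (_ : MeasurableSpace Ω) (μ : Measure Ω) (_ : IsProbabilityMeasure μ)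
      (p : Ω → X → A → ℝ) (q : Ω → Y → B → ℝ),
      (∀ x a, Measurable fun ω => p ω x a) ∧ (∀ y b, Measurable fun ω => q ω y b) ∧
      (∀ ω x a, 0 ≤ p ω x a) ∧ (∀ ω x, ∑ a, p ω x a = 1) ∧
      (∀ ω y b, 0 ≤ q ω y b) ∧ (∀ ω y, ∑ b, q ω y b = 1) ∧
      ∀ x y a b, P x y a b = ∫ ω, p ω x a * q ω y b ∂μ}

/-- A measurement with outcomes in `A`: positive operators adding up to the identity. -/
def IsPOVM {H : Type} [NormedAddCommGroup H] [InnerProductSpace ℂ H] [Fintype A]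
    (E : A → H →L[ℂ] H) : Prop :=
  (∀ a, (E a).IsPositive) ∧ ∑ a, E a = 1

/-- The Hilbert space tensor product: the completion of the algebraic tensor product in its
inner product `⟪u ⊗ v, u' ⊗ v'⟫ = ⟪u, u'⟫ ⟪v, v'⟫`. -/
abbrev HilbertTensor (H K : Type) [NormedAddCommGroup H] [InnerProductSpace ℂ H]
    [NormedAddCommGroup K] [InnerProductSpace ℂ K] : Type :=
  UniformSpace.Completion (H ⊗[ℂ] K)

/-- The bounded operator `S ⊗ T` on the Hilbert space tensor product. -/
noncomputable def tensorOp {H K : Type} [NormedAddCommGroup H] [InnerProductSpace ℂ H]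
    [NormedAddCommGroup K] [InnerProductSpace ℂ K] (S : H →L[ℂ] H) (T : K →L[ℂ] K) :
    HilbertTensor H K →L[ℂ] HilbertTensor H K :=
  (TensorProduct.mapL S T).completion

/-- The trace of `T`, computed in the orthonormal basis `e`, exists and equals `t`. For operators
`T = S ∘ ρ` with `ρ` positive of finite trace and `S` bounded it does not depend on `e`. -/
def HasTrace {H ι : Type} [NormedAddCommGroup H] [InnerProductSpace ℂ H] [CompleteSpace H]
    (e : HilbertBasis ι ℂ H) (T : H →L[ℂ] H) (t : ℂ) : Prop :=
  HasSum (fun i => ⟪e i, T (e i)⟫_ℂ) t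

/-- The quantum bipartite probability distributions: those of the form
`P(a, b | x, y) = tr ((E_x^a ⊗ F_y^b) ρ)` with `ρ` a density operator (positive, of trace one) on
the tensor product of two Hilbert spaces and with measurements `E_x`, `F_y` on the factors. -/
def quantumSet (X Y A B : Type) [Fintype A] [Fintype B] : Set (Behaviour X Y A B) :=
  {P | P.IsDistribution ∧
    ∃ (H : Type) (_ : NormedAddCommGroup H) (_ : InnerProductSpace ℂ H) (_ : CompleteSpace H)
      (K : Type) (_ : NormedAddCommGroup K) (_ : InnerProductSpace ℂ K) (_ : CompleteSpace K)
      (ι : Type) (e : HilbertBasis ι ℂ (HilbertTensor H K))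
      (ρ : HilbertTensor H K →L[ℂ] HilbertTensor H K)
      (E : X → A → H →L[ℂ] H) (F : Y → B → K →L[ℂ] K),
      ρ.IsPositive ∧ HasTrace e ρ 1 ∧ (∀ x, IsPOVM (E x)) ∧ (∀ y, IsPOVM (F y)) ∧
      ∀ x y a b, HasTrace e (tensorOp (E x a) (F y b) ∘L ρ) (P x y a b : ℂ)}

variable [Fintype X] [Fintype Y] [Fintype A] [Fintype B]

/-- `ω(F) = sup |⟨F, P⟩|` over the classical distributions `P`. -/
noncomputable def classicalValue (F : BellFunctional X Y A B) : ℝ :=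
  sSup ((fun P => |F.pairing P|) '' classicalSet X Y A B)

/-- `ω*(F) = sup |⟨F, P⟩|` over the quantum distributions `P`. -/
noncomputable def quantumValue (F : BellFunctional X Y A B) : ℝ :=
  sSup ((fun P => |F.pairing P|) '' quantumSet X Y A B)

end Bell

/-!
The violation is exhibited by a hidden matching game over a finite field `F` with `q` elements,
`q` an odd prime between `n² / 2` and `n²`, in which Bob is asked about all edges of a perfect
matching at once, each edge weighted by a phase, so that he needs only two outputs.

Let `χ` be a primitive additive character of `F`. For an input `x` of Alice, her output `(a, σ)`
selects a vector of a basis of `ℂ^(F ⊕ F)` with blocks of phases `U i = χ (a i + x₁ i²)` and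
`σ conj (V j)`, where `V j = χ ((a + x₂) j + x₃ j²)`. Bob's input `(m, s, t)` describes the matching
between the blocks that joins `i` to `i + m`, with weights `I^t χ (s i)`. The coefficient of the
functional is `± Re (I^t ∑ i, χ (s i) U i V (i + m))`.

*Quantum value.* On the maximally entangled state, if Alice measures in her basis and Bob measures
the sign on the edges of his matching, the bias of Bob's answer is proportional to the coefficient
(`sum_norm_sq_sub_eq_matchingCoeff`). The value is a sum of squares, which Parseval's identity
evaluates to `q^5` (`pow_five_le_quantumValue`).

*Classical value.* For a fixed strategy of Bob, Parseval's identity bounds his contribution by a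
bilinear form `∑ C i j U i V j` with `∑ ‖C i j‖² ≤ 2 q³` (`exists_sum_matchingCoeff_mul_eq`), and
Alice chooses for each `x` the output that makes the form largest. A maximum over `2 q` outputs is
at most the fourth root of the sum of the fourth powers. The fourth moment of the form over all
inputs and outputs of Alice is as small as for independent phases, because a pair of elements of
`F` is determined up to order by its sum and its sum of squares (`sum_norm_quadratic_pow_four_le`,
`sum_norm_bilinear_pow_four_le`). This gives `33 q^(19/4)` (`classicalValue_le`).

So the ratio is at least `q^(1/4) / 33`, of order `√n`. The input sets have `q³` and `2 q²`
elements; they are embedded into the larger prescribed sets, and the functional is extended by zero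
(`biasFunctional`).
-/

open scoped ComplexConjugate

/-! ### Interchange of double sums -/

theorem sum_sum_sum_sum_comm {α β γ δ M : Type*} [Fintype α] [Fintype β] [Fintype γ] [Fintype δ]
    [AddCommMonoid M] (g : α → β → γ → δ → M) :
    ∑ a, ∑ b, ∑ c, ∑ d, g a b c d = ∑ c, ∑ d, ∑ a, ∑ b, g a b c d := by
  have := Finset.sum_comm (s := (Finset.univ : Finset (α × β)))
    (t := (Finset.univ : Finset (γ × δ))) (f := fun p r => g p.1 p.2 r.1 r.2)
  simpa only [Fintype.sum_prod_type] using this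

/-! ### Measurements of the maximally entangled state -/

section Quantum

/-- Vectors satisfying the completeness relation `∑ |f a j⟩⟨f a j| = 1` give a measurement with
operators `∑ j, |f a j⟩⟨f a j|`. -/
theorem isPOVM_of_sum_rankOne {A J κ : Type} [Fintype A] [Fintype J] [Fintype κ] [DecidableEq κ]
    (f : A → J → κ → ℂ)
    (hf : ∀ k l, ∑ a, ∑ j, f a j k * conj (f a j l) = if k = l then 1 else 0) :
    IsPOVM fun a => ∑ j, InnerProductSpace.rankOne ℂ (WithLp.toLp 2 (f a j) : EuclideanSpace ℂ κ)
      (WithLp.toLp 2 (f a j)) := by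
  refine ⟨fun a => ContinuousLinearMap.isPositive_sum _ fun j _ =>
    InnerProductSpace.isPositive_rankOne_self _, ?_⟩
  ext v k
  have h : ∀ l, ∑ a, ∑ j, v l * conj (f a j l) * f a j k = if k = l then v l else 0 := by
    intro l
    have := congrArg (v l * ·) (hf k l)
    simp only [Finset.mul_sum] at this
    rw [mul_ite, mul_one, mul_zero] at this
    rw [← this]
    exact Finset.sum_congr rfl fun a _ => Finset.sum_congr rfl fun j _ => by ring
  have h2 : ∑ a, ∑ j, ∑ l, v l * conj (f a j l) * f a j k = v k := by
    rw [Finset.sum_congr rfl fun a _ => Finset.sum_comm, Finset.sum_comm]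
    simp [h]
  simp only [sum_apply, InnerProductSpace.rankOne_apply, WithLp.ofLp_sum,
    Finset.sum_apply, PiLp.smul_apply, smul_eq_mul, PiLp.inner_apply, RCLike.inner_apply,
    Finset.sum_mul, one_apply_eq_self]
  exact h2

/-- The trace of `T |ψ⟩⟨ψ|` is `⟨ψ, T ψ⟩`, in whatever orthonormal basis it is computed. -/
theorem hasTrace_comp_rankOne {H ι : Type} [NormedAddCommGroup H] [InnerProductSpace ℂ H]
    [CompleteSpace H] (e : HilbertBasis ι ℂ H) (T : H →L[ℂ] H) (ψ : H) :
    HasTrace e (T ∘L InnerProductSpace.rankOne ℂ ψ ψ) ⟪ψ, T ψ⟫_ℂ := by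
  have := e.hasSum_inner_mul_inner ψ (T ψ)
  simpa only [HasTrace, ContinuousLinearMap.comp_apply, InnerProductSpace.rankOne_apply, map_smul,
    inner_smul_right] using this

/-- The unnormalised maximally entangled vector `∑ e_k ⊗ e_k`. -/
noncomputable def entangledVector (κ : Type) [Fintype κ] [DecidableEq κ] :
    EuclideanSpace ℂ κ ⊗[ℂ] EuclideanSpace ℂ κ :=
  ∑ k, EuclideanSpace.single k 1 ⊗ₜ[ℂ] EuclideanSpace.single k 1

theorem inner_entangledVector_self (κ : Type) [Fintype κ] [DecidableEq κ] :
    ⟪entangledVector κ, entangledVector κ⟫_ℂ = Fintype.card κ := by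
  simp [entangledVector, sum_inner, inner_sum, TensorProduct.inner_tmul,
    EuclideanSpace.inner_single_left]

/-- The scalar action here is that of the algebraic tensor product, on which `inner_smul_left` and
`inner_smul_right` do not rewrite. -/
theorem inner_smul_smul_tensor {κ : Type} [Fintype κ] (c : ℂ)
    (v w : EuclideanSpace ℂ κ ⊗[ℂ] EuclideanSpace ℂ κ) :
    ⟪c • v, c • w⟫_ℂ = conj c * c * ⟪v, w⟫_ℂ := by
  rw [mul_assoc]
  exact (inner_smul_left v (c • w) c).trans (congrArg _ (inner_smul_right v w c))

/-- The vector `∑ e_k ⊗ e_k` turns the rank one projections onto `w` and `f` into the square of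
the bilinear pairing of `w` and `f`. -/
theorem inner_entangledVector_mapL {κ J : Type} [Fintype κ] [DecidableEq κ] [Fintype J]
    (w : κ → ℂ) (f : J → κ → ℂ) :
    ⟪entangledVector κ, TensorProduct.mapL
      (InnerProductSpace.rankOne ℂ (WithLp.toLp 2 w : EuclideanSpace ℂ κ) (WithLp.toLp 2 w))
      (∑ j, InnerProductSpace.rankOne ℂ (WithLp.toLp 2 (f j) : EuclideanSpace ℂ κ)
        (WithLp.toLp 2 (f j))) (entangledVector κ)⟫_ℂ =
      ((∑ j, ‖∑ k, w k * f j k‖ ^ 2 : ℝ) : ℂ) := by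
  have h : ∀ j, ((‖∑ k, w k * f j k‖ ^ 2 : ℝ) : ℂ) =
      ∑ k, ∑ l, conj (w k) * conj (f j k) * (w l * f j l) := by
    intro j
    rw [← Complex.normSq_eq_norm_sq, Complex.normSq_eq_conj_mul_self, map_sum, Finset.sum_mul_sum]
    simp
  rw [Complex.ofReal_sum, Finset.sum_congr rfl fun j _ => h j]
  simp only [entangledVector, sum_inner, map_sum, TensorProduct.mapL_tmul,
    sum_apply, InnerProductSpace.rankOne_apply, TensorProduct.tmul_sum,
    inner_sum, TensorProduct.inner_tmul, inner_smul_right, EuclideanSpace.inner_single_left,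
    EuclideanSpace.inner_single_right, map_one, one_mul]
  rw [Finset.sum_comm]
  refine Finset.sum_congr rfl fun j _ => Finset.sum_congr rfl fun k _ =>
    Finset.sum_congr rfl fun l _ => by ring

/-- Measuring the maximally entangled state, Alice with the rank one operators `|w⟩⟨w|` and Bob
with the operators `∑ j, |f j⟩⟨f j|`. -/
theorem mem_quantumSet_of_vectors {X Y A B κ J : Type} [Fintype A] [Fintype B] [Fintype κ]
    [DecidableEq κ] [Nonempty κ] [Fintype J] (w : X → A → κ → ℂ) (f : Y → B → J → κ → ℂ)
    (hw : ∀ x k l, ∑ a, w x a k * conj (w x a l) = if k = l then 1 else 0)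
    (hf : ∀ y k l, ∑ b, ∑ j, f y b j k * conj (f y b j l) = if k = l then 1 else 0) :
    (fun x y a b => (Fintype.card κ : ℝ)⁻¹ * ∑ j, ‖∑ k, w x a k * f y b j k‖ ^ 2) ∈
      quantumSet X Y A B := by
  have hcard : (Fintype.card κ : ℝ) ≠ 0 := Nat.cast_ne_zero.2 Fintype.card_ne_zero
  refine ⟨⟨fun x y a b => by positivity, fun x y => ?_⟩, ?_⟩
  · simp only [← Finset.mul_sum]
    rw [inv_mul_eq_one₀ hcard]
    have h : ∀ a b j, ((‖∑ k, w x a k * f y b j k‖ ^ 2 : ℝ) : ℂ) =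
        ∑ k, ∑ l, (w x a k * conj (w x a l)) * (f y b j k * conj (f y b j l)) := by
      intro a b j
      rw [← Complex.normSq_eq_norm_sq, Complex.normSq_eq_conj_mul_self, map_sum, mul_comm,
        Finset.sum_mul_sum]
      refine Finset.sum_congr rfl fun k _ => Finset.sum_congr rfl fun l _ => ?_
      rw [map_mul]; ring
    apply Complex.ofReal_injective
    push_cast
    simp only [← Complex.ofReal_pow, h]
    have h' : ∀ a, ∑ b, ∑ j, ∑ k, ∑ l,
        (w x a k * conj (w x a l)) * (f y b j k * conj (f y b j l)) =
        ∑ k, w x a k * conj (w x a k) := by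
      intro a
      rw [sum_sum_sum_sum_comm]
      simp only [← Finset.mul_sum, hf]
      simp
    simp only [h']
    rw [Finset.sum_comm]
    simp [hw]
  · obtain ⟨ι, e, -⟩ := exists_hilbertBasis ℂ
      (HilbertTensor (EuclideanSpace ℂ κ) (EuclideanSpace ℂ κ))
    let c : ℂ := ((Real.sqrt (Fintype.card κ))⁻¹ : ℝ)
    have hc : conj c * c = ((Fintype.card κ : ℝ)⁻¹ : ℝ) := by
      rw [Complex.conj_ofReal, ← Complex.ofReal_mul, ← mul_inv,
        Real.mul_self_sqrt (Nat.cast_nonneg _)]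
    let ψ : HilbertTensor (EuclideanSpace ℂ κ) (EuclideanSpace ℂ κ) :=
      ((c • entangledVector κ : EuclideanSpace ℂ κ ⊗[ℂ] EuclideanSpace ℂ κ) :)
    refine ⟨EuclideanSpace ℂ κ, inferInstance, inferInstance, inferInstance,
      EuclideanSpace ℂ κ, inferInstance, inferInstance, inferInstance, ι, e,
      InnerProductSpace.rankOne ℂ ψ ψ,
      fun x a => InnerProductSpace.rankOne ℂ (WithLp.toLp 2 (w x a)) (WithLp.toLp 2 (w x a)),
      fun y b => ∑ j, InnerProductSpace.rankOne ℂ (WithLp.toLp 2 (f y b j))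
        (WithLp.toLp 2 (f y b j)),
      InnerProductSpace.isPositive_rankOne_self _, ?_, fun x => ?_,
      fun y => isPOVM_of_sum_rankOne (f y) (hf y), fun x y a b => ?_⟩
    · have := hasTrace_comp_rankOne e (ContinuousLinearMap.id ℂ _) ψ
      rw [ContinuousLinearMap.id_comp, ContinuousLinearMap.id_apply,
        UniformSpace.Completion.inner_coe, inner_smul_smul_tensor,
        inner_entangledVector_self, hc] at this
      convert this using 1
      push_cast
      rw [inv_mul_cancel₀]
      exact_mod_cast hcard
    · have := isPOVM_of_sum_rankOne (fun a (_ : Unit) => w x a) (fun k l => by simpa using hw x k l)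
      simpa using this
    · have := hasTrace_comp_rankOne e (tensorOp
        (InnerProductSpace.rankOne ℂ (WithLp.toLp 2 (w x a) : EuclideanSpace ℂ κ)
          (WithLp.toLp 2 (w x a)))
        (∑ j, InnerProductSpace.rankOne ℂ (WithLp.toLp 2 (f y b j) : EuclideanSpace ℂ κ)
          (WithLp.toLp 2 (f y b j)))) ψ
      convert this using 1
      rw [tensorOp, ContinuousLinearMap.completion_apply_coe, UniformSpace.Completion.inner_coe,
        map_smul, inner_smul_smul_tensor, inner_entangledVector_mapL, hc,
        ← Complex.ofReal_mul]

end Quantum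

/-! ### Fourth moments of quadratic exponential sums -/

section FourthMoment

/-- A pair is determined up to order by its sum and its sum of squares. -/
theorem pair_eq_of_sum_eq_of_sum_sq_eq {F : Type} [Field F] (h2 : (2 : F) ≠ 0) {i i' j j' : F}
    (h₁ : i + i' - j - j' = 0) (h₂ : i ^ 2 + i' ^ 2 - j ^ 2 - j' ^ 2 = 0) :
    (i = j ∧ i' = j') ∨ (i = j' ∧ i' = j) := by
  have hi' : i' = j + j' - i := by linear_combination h₁
  subst hi'
  have h : 2 * ((i - j) * (i - j')) = 0 := by linear_combination h₂
  rcases mul_eq_zero.1 ((mul_eq_zero.1 h).resolve_left h2) with h | h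
  · left; rw [sub_eq_zero.1 h]; simp
  · right; rw [sub_eq_zero.1 h]; simp

variable {F : Type} [Field F] [Fintype F] [DecidableEq F] {χ : AddChar F ℂ}

theorem sum_sum_addChar_mul_add (hχ : χ.IsPrimitive) (s t : F) :
    ∑ a, ∑ x, χ (a * s + x * t) = if s = 0 ∧ t = 0 then (Fintype.card F : ℂ) ^ 2 else 0 := by
  simp only [AddChar.map_add_eq_mul, ← Finset.mul_sum, ← Finset.sum_mul, AddChar.sum_mulShift _ hχ]
  by_cases hs : s = 0 <;> by_cases ht : t = 0 <;> simp [hs, ht, sq]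

/-- Fourth moments of the exponential sums `∑ i, b i * χ (a i + x i²)`: although `(a, x)` takes
only `q²` values, they are no larger than for independent phases. -/
theorem sum_norm_quadratic_pow_four_le (hχ : χ.IsPrimitive) (h2 : (2 : F) ≠ 0) (b : F → ℂ) :
    ∑ a, ∑ x, ‖∑ i, b i * χ (a * i + x * i ^ 2)‖ ^ 4 ≤
      2 * (Fintype.card F : ℝ) ^ 2 * (∑ i, ‖b i‖ ^ 2) ^ 2 := by
  set u : F → F → F → ℂ := fun a x i => χ (a * i + x * i ^ 2) with hu
  have hexp : ∀ a x, ((‖∑ i, b i * u a x i‖ ^ 4 : ℝ) : ℂ) =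
      ∑ i, ∑ i', ∑ j, ∑ j', (b i * b i' * conj (b j) * conj (b j')) *
        χ (a * (i + i' - j - j') + x * (i ^ 2 + i' ^ 2 - j ^ 2 - j' ^ 2)) := by
    intro a x
    have h1 : ((‖∑ i, b i * u a x i‖ ^ 4 : ℝ) : ℂ) =
        ((∑ i, b i * u a x i) * (∑ i, b i * u a x i)) *
          (conj (∑ i, b i * u a x i) * conj (∑ i, b i * u a x i)) := by
      rw [mul_mul_mul_comm, Complex.mul_conj, Complex.normSq_eq_norm_sq]
      push_cast; ring
    rw [h1, map_sum]
    simp only [Finset.sum_mul_sum]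
    refine Finset.sum_congr rfl fun i _ => ?_
    rw [Finset.sum_comm]
    refine Finset.sum_congr rfl fun i' _ => Finset.sum_congr rfl fun j _ =>
      Finset.sum_congr rfl fun j' _ => ?_
    have : a * (i + i' - j - j') + x * (i ^ 2 + i' ^ 2 - j ^ 2 - j' ^ 2) =
      (a * i + x * i ^ 2) + (a * i' + x * i' ^ 2) + -(a * j + x * j ^ 2) +
        -(a * j' + x * j' ^ 2) := by ring
    rw [this]
    simp only [AddChar.map_add_eq_mul, AddChar.map_neg_eq_conj, map_mul, hu]
    ring
  have hsum : ((∑ a, ∑ x, ‖∑ i, b i * u a x i‖ ^ 4 : ℝ) : ℂ) =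
      ∑ i, ∑ i', ∑ j, ∑ j', (b i * b i' * conj (b j) * conj (b j')) *
        (if i + i' - j - j' = 0 ∧ i ^ 2 + i' ^ 2 - j ^ 2 - j' ^ 2 = 0
          then (Fintype.card F : ℂ) ^ 2 else 0) := by
    simp only [Complex.ofReal_sum, hexp, ← sum_sum_addChar_mul_add hχ, Finset.mul_sum]
    rw [sum_sum_sum_sum_comm]
    exact Finset.sum_congr rfl fun i _ => Finset.sum_congr rfl fun i' _ => sum_sum_sum_sum_comm _
  have hnonneg : (0 : ℝ) ≤ ∑ a, ∑ x, ‖∑ i, b i * u a x i‖ ^ 4 := by positivity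
  calc ∑ a, ∑ x, ‖∑ i, b i * u a x i‖ ^ 4
      = ‖((∑ a, ∑ x, ‖∑ i, b i * u a x i‖ ^ 4 : ℝ) : ℂ)‖ := by
        rw [Complex.norm_real, Real.norm_of_nonneg hnonneg]
    _ ≤ ∑ i, ∑ i', ∑ j, ∑ j', (‖b i‖ * ‖b i'‖ * ‖b j‖ * ‖b j'‖) *
        ((if i = j then if i' = j' then (Fintype.card F : ℝ) ^ 2 else 0 else 0) +
          (if i' = j then if i = j' then (Fintype.card F : ℝ) ^ 2 else 0 else 0)) := by
        rw [hsum]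
        refine norm_sum_le_of_le _ fun i _ => norm_sum_le_of_le _ fun i' _ =>
          norm_sum_le_of_le _ fun j _ => norm_sum_le_of_le _ fun j' _ => ?_
        rw [norm_mul]
        simp only [norm_mul, RCLike.norm_conj]
        refine mul_le_mul_of_nonneg_left ?_ (by positivity)
        have hpos : ∀ p p' : Prop, ∀ [Decidable p] [Decidable p'],
            (0 : ℝ) ≤ if p then if p' then (Fintype.card F : ℝ) ^ 2 else 0 else 0 := by
          intro p p' _ _
          split_ifs <;> positivity
        by_cases h : i + i' - j - j' = 0 ∧ i ^ 2 + i' ^ 2 - j ^ 2 - j' ^ 2 = 0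
        · rw [if_pos h, norm_pow, Complex.norm_natCast]
          rcases pair_eq_of_sum_eq_of_sum_sq_eq h2 h.1 h.2 with ⟨h₁, h₂⟩ | ⟨h₁, h₂⟩
          · rw [if_pos h₁, if_pos h₂]
            exact le_add_of_nonneg_right (hpos _ _)
          · rw [if_pos h₂, if_pos h₁]
            exact le_add_of_nonneg_left (hpos _ _)
        · rw [if_neg h, norm_zero]
          exact add_nonneg (hpos _ _) (hpos _ _)
    _ = 2 * (Fintype.card F : ℝ) ^ 2 * (∑ i, ‖b i‖ ^ 2) ^ 2 := by
        rw [sq (∑ i, ‖b i‖ ^ 2), Finset.sum_mul_sum, Finset.mul_sum]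
        refine Finset.sum_congr rfl fun i _ => ?_
        rw [Finset.mul_sum]
        refine Finset.sum_congr rfl fun i' _ => ?_
        simp only [mul_add, Finset.sum_add_distrib, mul_ite, mul_zero]
        simp
        ring

/-- Fourth moments of bilinear forms in two independent families of quadratic phases. -/
theorem sum_norm_bilinear_pow_four_le (hχ : χ.IsPrimitive) (h2 : (2 : F) ≠ 0) (C : F → F → ℂ) :
    ∑ a, ∑ x, ∑ a', ∑ x', ‖∑ i, ∑ j, C i j * χ (a * i + x * i ^ 2) * χ (a' * j + x' * j ^ 2)‖ ^ 4 ≤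
      4 * (Fintype.card F : ℝ) ^ 4 * (∑ i, ∑ j, ‖C i j‖ ^ 2) ^ 2 := by
  set q : ℝ := (Fintype.card F : ℝ) with hq
  have hq0 : 0 ≤ q := Nat.cast_nonneg _
  let d : F → F → F → ℂ := fun a x j => ∑ i, C i j * χ (a * i + x * i ^ 2)
  let N : F → ℝ := fun j => ∑ i, ‖C i j‖ ^ 2
  have hN0 : ∀ j, 0 ≤ N j := fun j => by positivity
  have hd : ∀ j, ∑ p : F × F, (‖d p.1 p.2 j‖ ^ 2) ^ 2 ≤ 2 * q ^ 2 * N j ^ 2 := by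
    intro j
    rw [Fintype.sum_prod_type]
    simp only [← pow_mul]
    exact sum_norm_quadratic_pow_four_le hχ h2 fun i => C i j
  have hcs : ∀ j k, ∑ p : F × F, ‖d p.1 p.2 j‖ ^ 2 * ‖d p.1 p.2 k‖ ^ 2 ≤
      2 * q ^ 2 * (N j * N k) := by
    intro j k
    refine abs_le_of_sq_le_sq' ?_ (by have := hN0 j; have := hN0 k; positivity) |>.2
    refine (Finset.sum_mul_sq_le_sq_mul_sq _ _ _).trans ?_
    refine (mul_le_mul (hd j) (hd k) (by positivity) (by positivity)).trans (le_of_eq ?_)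
    ring
  have inner : ∀ a x, ∑ a', ∑ x',
      ‖∑ i, ∑ j, C i j * χ (a * i + x * i ^ 2) * χ (a' * j + x' * j ^ 2)‖ ^ 4 ≤
      2 * q ^ 2 * (∑ j, ‖d a x j‖ ^ 2) ^ 2 := by
    intro a x
    refine le_trans (le_of_eq ?_) (sum_norm_quadratic_pow_four_le hχ h2 fun j => d a x j)
    refine Finset.sum_congr rfl fun a' _ => Finset.sum_congr rfl fun x' _ => ?_
    rw [Finset.sum_comm]
    simp only [d, Finset.sum_mul]
  calc _ ≤ ∑ a, ∑ x, 2 * q ^ 2 * (∑ j, ‖d a x j‖ ^ 2) ^ 2 :=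
        Finset.sum_le_sum fun a _ => Finset.sum_le_sum fun x _ => inner a x
    _ = 2 * q ^ 2 * ∑ j, ∑ k, ∑ p : F × F, ‖d p.1 p.2 j‖ ^ 2 * ‖d p.1 p.2 k‖ ^ 2 := by
        simp only [← Finset.mul_sum]
        congr 1
        rw [← Fintype.sum_prod_type' fun a x => (∑ j, ‖d a x j‖ ^ 2) ^ 2]
        simp only [sq (∑ j, _), Finset.sum_mul_sum]
        rw [Finset.sum_comm]
        exact Finset.sum_congr rfl fun j _ => Finset.sum_comm
    _ ≤ 2 * q ^ 2 * ∑ j, ∑ k, 2 * q ^ 2 * (N j * N k) := by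
        refine mul_le_mul_of_nonneg_left ?_ (by positivity)
        exact Finset.sum_le_sum fun j _ => Finset.sum_le_sum fun k _ => hcs j k
    _ = _ := by
        rw [Finset.sum_comm (f := fun i j => ‖C i j‖ ^ 2), sq (∑ j, _), Finset.sum_mul_sum]
        simp only [Finset.mul_sum]
        refine Finset.sum_congr rfl fun j _ => Finset.sum_congr rfl fun k _ => ?_
        simp only [N, Finset.sum_mul, Finset.mul_sum]
        refine Finset.sum_congr rfl fun _ _ => Finset.sum_congr rfl fun _ _ => by ring

end FourthMoment

/-! ### Functionals of Bob's bias -/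

section Functional

variable {X Y A X' Y' A' : Type} [Fintype X'] [Fintype Y'] [Fintype A']

/-- The sign `(-1)^b` attached to an outcome `b` of a dichotomic measurement. -/
def outcomeSign (b : Fin 2) : ℝ := (-1) ^ (b : ℕ)

@[simp] theorem outcomeSign_zero : outcomeSign 0 = 1 := rfl

@[simp] theorem outcomeSign_one : outcomeSign 1 = -1 := by simp [outcomeSign]

theorem outcomeSign_mul_self (b : Fin 2) : outcomeSign b * outcomeSign b = 1 := by
  fin_cases b <;> simp

theorem abs_outcomeSign (b : Fin 2) : |outcomeSign b| = 1 := by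
  fin_cases b <;> simp

/-- The functional with coefficient `(-1)^b G x y a` at the images of `x, y, a` under the given
relabellings of inputs and outputs, and with coefficient zero outside their ranges. It sees
Bob's answer only through the bias `P(a, 0 | x, y) - P(a, 1 | x, y)`. -/
noncomputable def biasFunctional [DecidableEq X] [DecidableEq Y] [DecidableEq A]
    (ιX : X' → X) (ιY : Y' → Y) (ιA : A' → A) (G : X' → Y' → A' → ℝ) :
    BellFunctional X Y A (Fin 2) := fun x y a b =>
  ∑ r : X' × Y' × A', if (ιX r.1, ιY r.2.1, ιA r.2.2) = (x, y, a)
    then outcomeSign b * G r.1 r.2.1 r.2.2 else 0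

variable [Fintype X] [Fintype Y] [Fintype A]

theorem bddAbove_abs_pairing {B : Type} [Fintype B] (F : BellFunctional X Y A B)
    {S : Set (Behaviour X Y A B)} (hS : ∀ P ∈ S, P.IsDistribution) :
    BddAbove ((fun P => |F.pairing P|) '' S) := by
  refine ⟨∑ x, ∑ y, ∑ a, ∑ b, |F x y a b|, ?_⟩
  rintro _ ⟨P, hP, rfl⟩
  obtain ⟨h0, h1⟩ := hS P hP
  have hle : ∀ x y a b, P x y a b ≤ 1 := by
    intro x y a b
    rw [← h1 x y]
    refine le_trans ?_ (Finset.single_le_sum (f := fun a => ∑ b, P x y a b)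
      (fun a _ => Finset.sum_nonneg fun b _ => h0 x y a b) (Finset.mem_univ a))
    exact Finset.single_le_sum (f := fun b => P x y a b) (fun b _ => h0 x y a b)
      (Finset.mem_univ b)
  simp only [BellFunctional.pairing, ← Real.norm_eq_abs]
  refine norm_sum_le_of_le _ fun x _ => norm_sum_le_of_le _ fun y _ =>
    norm_sum_le_of_le _ fun a _ => norm_sum_le_of_le _ fun b _ => ?_
  rw [norm_mul, Real.norm_of_nonneg (h0 x y a b)]
  exact mul_le_of_le_one_right (norm_nonneg _) (hle x y a b)

variable [DecidableEq X] [DecidableEq Y] [DecidableEq A]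

theorem pairing_biasFunctional (ιX : X' → X) (ιY : Y' → Y) (ιA : A' → A) (G : X' → Y' → A' → ℝ)
    (P : Behaviour X Y A (Fin 2)) :
    (biasFunctional ιX ιY ιA G).pairing P = ∑ x, ∑ y, ∑ a,
      G x y a * (P (ιX x) (ιY y) (ιA a) 0 - P (ιX x) (ιY y) (ιA a) 1) := by
  have h : ∀ x y a, ∑ b, biasFunctional ιX ιY ιA G x y a b * P x y a b =
      ∑ r : X' × Y' × A', if (ιX r.1, ιY r.2.1, ιA r.2.2) = (x, y, a)
        then G r.1 r.2.1 r.2.2 * (P x y a 0 - P x y a 1) else 0 := by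
    intro x y a
    simp only [biasFunctional, Fin.sum_univ_two, Finset.sum_mul, ← Finset.sum_add_distrib]
    refine Finset.sum_congr rfl fun r _ => ?_
    split_ifs
    · simp; ring
    · simp
  simp only [BellFunctional.pairing, h]
  have e : ∀ g : X → Y → A → ℝ, ∑ x, ∑ y, ∑ a, g x y a =
      ∑ s : X × Y × A, g s.1 s.2.1 s.2.2 := fun g => by simp only [Fintype.sum_prod_type]
  have e' : ∀ g : X' → Y' → A' → ℝ, ∑ x, ∑ y, ∑ a, g x y a =
      ∑ s : X' × Y' × A', g s.1 s.2.1 s.2.2 := fun g => by simp only [Fintype.sum_prod_type]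
  rw [e, e', Finset.sum_comm]
  refine Finset.sum_congr rfl fun r _ => ?_
  simp

/-- To bound the classical value it is enough to bound the functional on products of a (possibly
incomplete) local response of Alice with a bias `f` of Bob. -/
theorem abs_pairing_biasFunctional_le {ιX : X' → X} {ιY : Y' → Y} {ιA : A' → A}
    (hA : Function.Injective ιA) {G : X' → Y' → A' → ℝ} {W : ℝ}
    (h : ∀ (p : X' → A' → ℝ) (f : Y' → ℝ), (∀ x a, 0 ≤ p x a) → (∀ x, ∑ a, p x a ≤ 1) →
      (∀ y, |f y| ≤ 1) → |∑ x, ∑ y, ∑ a, G x y a * (p x a * f y)| ≤ W)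
    {P : Behaviour X Y A (Fin 2)} (hP : P ∈ classicalSet X Y A (Fin 2)) :
    |(biasFunctional ιX ιY ιA G).pairing P| ≤ W := by
  obtain ⟨-, Ω, _, μ, _, p, q, hpm, hqm, hp0, hp1, hq0, hq1, hP⟩ := hP
  have hple : ∀ ω x a, p ω x a ≤ 1 := fun ω x a => by
    rw [← hp1 ω x]
    exact Finset.single_le_sum (fun a _ => hp0 ω x a) (Finset.mem_univ a)
  have hqle : ∀ ω y b, q ω y b ≤ 1 := fun ω y b => by
    rw [← hq1 ω y]
    exact Finset.single_le_sum (fun b _ => hq0 ω y b) (Finset.mem_univ b)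
  have hint : ∀ x y a b, Integrable (fun ω => p ω x a * q ω y b) μ := by
    intro x y a b
    refine Integrable.of_bound ((hpm x a).mul (hqm y b)).aestronglyMeasurable 1
      (Filter.Eventually.of_forall fun ω => ?_)
    rw [Real.norm_of_nonneg (mul_nonneg (hp0 ω x a) (hq0 ω y b))]
    exact mul_le_one₀ (hple ω x a) (hq0 ω y b) (hqle ω y b)
  have hint' : ∀ x y a, Integrable (fun ω => G x y a *
      (p ω (ιX x) (ιA a) * (q ω (ιY y) 0 - q ω (ιY y) 1))) μ := by
    intro x y a
    simp only [mul_sub (p _ _ _)]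
    exact ((hint _ _ _ _).sub (hint _ _ _ _)).const_mul _
  have key : (biasFunctional ιX ιY ιA G).pairing P = ∫ ω, ∑ x, ∑ y, ∑ a, G x y a *
      (p ω (ιX x) (ιA a) * (q ω (ιY y) 0 - q ω (ιY y) 1)) ∂μ := by
    rw [pairing_biasFunctional, integral_finsetSum _ fun x _ => integrable_finsetSum _ fun y _ =>
      integrable_finsetSum _ fun a _ => hint' x y a]
    refine Finset.sum_congr rfl fun x _ => ?_
    rw [integral_finsetSum _ fun y _ => integrable_finsetSum _ fun a _ => hint' x y a]
    refine Finset.sum_congr rfl fun y _ => ?_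
    rw [integral_finsetSum _ fun a _ => hint' x y a]
    refine Finset.sum_congr rfl fun a _ => ?_
    simp only [mul_sub (p _ _ _)]
    rw [integral_const_mul, integral_sub (hint _ _ _ _) (hint _ _ _ _), hP, hP]
  rw [key, ← Real.norm_eq_abs]
  refine (norm_integral_le_of_norm_le_const (C := W)
    (Filter.Eventually.of_forall fun ω => ?_)).trans (by simp)
  refine h (fun x a => p ω (ιX x) (ιA a)) (fun y => q ω (ιY y) 0 - q ω (ιY y) 1)
    (fun x a => hp0 _ _ _) (fun x => ?_) fun y => ?_
  · rw [← hp1 ω (ιX x)]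
    rw [← Finset.sum_image (f := fun a => p ω (ιX x) a) (s := Finset.univ) (g := ιA) hA.injOn]
    exact Finset.sum_le_sum_of_subset_of_nonneg (Finset.subset_univ _) fun a _ _ => hp0 _ _ _
  · rw [abs_le]
    constructor <;> linarith [hq0 ω (ιY y) 0, hq0 ω (ιY y) 1, hqle ω (ιY y) 0, hqle ω (ιY y) 1]

/-- The classical value is positive as soon as one coefficient does not vanish, if the coefficients
at Bob's input `y₀` cancel when Alice answers at random: then both players answer at random on
all other inputs. -/
theorem classicalValue_biasFunctional_pos {ιX : X' → X} {ιY : Y' → Y} {ιA : A' → A}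
    (hX : Function.Injective ιX) (hY : Function.Injective ιY) (hA : Function.Injective ιA)
    {G : X' → Y' → A' → ℝ} {x₀ : X'} {y₀ : Y'} {a₀ : A'} (hG : G x₀ y₀ a₀ ≠ 0)
    (hsum : ∀ x, ∑ a, G x y₀ a = 0) :
    0 < classicalValue (biasFunctional ιX ιY ιA G) := by
  let p : X → A → ℝ := fun x a =>
    if x = ιX x₀ then if a = ιA a₀ then 1 else 0 else (Fintype.card A : ℝ)⁻¹
  let q : Y → Fin 2 → ℝ := fun y b => if y = ιY y₀ then if b = 0 then 1 else 0 else 1 / 2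
  have hp0 : ∀ x a, 0 ≤ p x a := fun x a => by simp only [p]; split_ifs <;> positivity
  have hq0 : ∀ y b, 0 ≤ q y b := fun y b => by simp only [q]; split_ifs <;> positivity
  have hcard : (Fintype.card A : ℝ) ≠ 0 :=
    Nat.cast_ne_zero.2 (Fintype.card_pos_iff.2 ⟨ιA a₀⟩).ne'
  have hp1 : ∀ x, ∑ a, p x a = 1 := fun x => by
    simp only [p]
    split_ifs
    · simp
    · simp [hcard]
  have hq1 : ∀ y, ∑ b, q y b = 1 := fun y => by
    simp only [q]
    split_ifs
    · simp
    · norm_num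
  have hmem : (fun x y a b => p x a * q y b) ∈ classicalSet X Y A (Fin 2) := by
    refine ⟨⟨fun x y a b => mul_nonneg (hp0 x a) (hq0 y b), fun x y => ?_⟩, Unit, inferInstance,
      Measure.dirac (), inferInstance, fun _ => p, fun _ => q, fun _ _ => measurable_const,
      fun _ _ => measurable_const, fun _ => hp0, fun _ => hp1, fun _ => hq0, fun _ => hq1,
      fun x y a b => by simp⟩
    simp [← Finset.mul_sum, hq1, hp1]
  have hval : (biasFunctional ιX ιY ιA G).pairing (fun x y a b => p x a * q y b) =
      G x₀ y₀ a₀ := by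
    rw [pairing_biasFunctional, Finset.sum_eq_single x₀, Finset.sum_eq_single y₀,
      Finset.sum_eq_single a₀]
    · simp [p, q]
    · intro a _ ha
      simp [p, hA.ne ha]
    · simp
    · intro y _ hy
      simp [q, hY.ne hy]
    · simp
    · intro x _ hx
      rw [Finset.sum_eq_single y₀]
      · simp [p, q, hX.ne hx, ← Finset.sum_mul, hsum]
      · intro y _ hy
        simp [q, hY.ne hy]
      · simp
    · simp
  refine lt_of_lt_of_le ?_ (le_csSup (bddAbove_abs_pairing _ fun P hP => hP.1) ⟨_, hmem, rfl⟩)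
  simpa [hval] using hG

end Functional

/-! ### Quantum lower bounds for bias functionals -/

section Strategy

variable {X Y A X' Y' A' κ J : Type} [Fintype X'] [Fintype Y'] [Fintype A'] [Nonempty X']
  [Nonempty Y'] [Fintype X] [Fintype Y] [Fintype A] [DecidableEq X] [DecidableEq Y]
  [DecidableEq A] [Fintype κ] [DecidableEq κ] [Nonempty κ] [Fintype J]

/-- The value of a bias functional at the behaviour of `mem_quantumSet_of_vectors` is a lower
bound for its quantum value: measurements on the original inputs extend along the relabellings,
the additional outcomes of Alice being given the zero operator. -/
theorem sum_le_quantumValue_biasFunctional {ιX : X' → X} {ιY : Y' → Y} {ιA : A' → A}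
    (hX : Function.Injective ιX) (hY : Function.Injective ιY) (hA : Function.Injective ιA)
    (G : X' → Y' → A' → ℝ) (w : X' → A' → κ → ℂ) (f : Y' → Fin 2 → J → κ → ℂ)
    (hw : ∀ x k l, ∑ a, w x a k * conj (w x a l) = if k = l then 1 else 0)
    (hf : ∀ y k l, ∑ b, ∑ j, f y b j k * conj (f y b j l) = if k = l then 1 else 0) :
    ∑ x, ∑ y, ∑ a, G x y a * ((Fintype.card κ : ℝ)⁻¹ *
      ∑ j, (‖∑ k, w x a k * f y 0 j k‖ ^ 2 - ‖∑ k, w x a k * f y 1 j k‖ ^ 2)) ≤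
      quantumValue (biasFunctional ιX ιY ιA G) := by
  let w' : X → A → κ → ℂ := fun x => Function.extend ιA (w (Function.invFun ιX x)) 0
  let f' : Y → Fin 2 → J → κ → ℂ := fun y => f (Function.invFun ιY y)
  have hw' : ∀ x k l, ∑ a, w' x a k * conj (w' x a l) = if k = l then 1 else 0 := by
    intro x k l
    rw [← hw (Function.invFun ιX x) k l]
    refine (Fintype.sum_of_injective ιA hA _ _ (fun a ha => ?_) fun a => ?_).symm
    · simp [w', Function.extend_apply' _ _ _ ha]
    · simp [w', hA.extend_apply]
  have hmem := mem_quantumSet_of_vectors w' f' hw' fun y => hf (Function.invFun ιY y)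
  refine le_trans (le_of_eq ?_) ((le_abs_self _).trans
    (le_csSup (bddAbove_abs_pairing _ fun P hP => hP.1) ⟨_, hmem, rfl⟩))
  rw [pairing_biasFunctional]
  refine Finset.sum_congr rfl fun x _ => Finset.sum_congr rfl fun y _ =>
    Finset.sum_congr rfl fun a _ => ?_
  simp only [w', f', Function.leftInverse_invFun hX x, Function.leftInverse_invFun hY y,
    hA.extend_apply, ← mul_sub, ← Finset.sum_sub_distrib]

end Strategy

/-! ### The weighted matching functional and its strategy -/

section Phases

variable {F : Type} [Field F]

/-- Alice's phases on the first block, for the input `(x, y, z)`: `χ (a i + x i²)`. -/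
noncomputable def phaseLeft (χ : AddChar F ℂ) (x : F × F × F) (a i : F) : ℂ :=
  χ (a * i + x.1 * i ^ 2)

/-- Alice's phases on the second block, for the input `(x, y, z)`: `χ ((a + y) j + z j²)`.
The input `y` shifts the linear coefficient, so that the two blocks become independent once all
inputs and outputs are averaged over. -/
noncomputable def phaseRight (χ : AddChar F ℂ) (x : F × F × F) (a j : F) : ℂ :=
  χ ((a + x.2.1) * j + x.2.2 * j ^ 2)

variable [Fintype F]

/-- The correlation of the two blocks of phases along the matching `i ↦ i + m`, with the edges
weighted by `χ (s i)`. -/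
noncomputable def matchingSum (χ : AddChar F ℂ) (x : F × F × F) (a m s : F) : ℂ :=
  ∑ i, χ (s * i) * (phaseLeft χ x a i * phaseRight χ x a (i + m))

/-- The coefficients of the Bell functional: `± Re (matchingSum)` or `∓ Im (matchingSum)`,
according to Bob's last input. -/
noncomputable def matchingCoeff (χ : AddChar F ℂ) (x : F × F × F) (y : F × F × Fin 2)
    (a : F × Fin 2) : ℝ :=
  outcomeSign a.2 * (Complex.I ^ (y.2.2 : ℕ) * matchingSum χ x a.1 y.1 y.2.1).re

/-- Alice's basis of `ℂ^(F ⊕ F)` for the input `x`: the two blocks of phases, the second one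
conjugated and with a sign. -/
noncomputable def aliceVector (χ : AddChar F ℂ) (x : F × F × F) (a : F × Fin 2) : F ⊕ F → ℂ :=
  Sum.elim (fun i => (Real.sqrt (2 * Fintype.card F))⁻¹ * phaseLeft χ x a.1 i)
    (fun j => (Real.sqrt (2 * Fintype.card F))⁻¹ *
      (outcomeSign a.2 * conj (phaseRight χ x a.1 j)))

omit [Fintype F] in
/-- Bob's basis of `ℂ^(F ⊕ F)` for the input `y = (m, s, t)`: a pair of vectors, told apart by
the sign, on each edge `{i, i + m}` of a perfect matching between the two blocks. -/
noncomputable def bobVector [DecidableEq F] (χ : AddChar F ℂ) (y : F × F × Fin 2) (b : Fin 2)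
    (i : F) : F ⊕ F → ℂ :=
  Sum.elim (fun k => if k = i then ((Real.sqrt 2)⁻¹ : ℂ) else 0)
    (fun k => if k = i + y.1 then ((Real.sqrt 2)⁻¹ : ℂ) *
      (outcomeSign b * conj (Complex.I ^ (y.2.2 : ℕ) * χ (y.2.1 * i))) else 0)

end Phases

section Values

variable {F : Type} [Field F] [Fintype F] [DecidableEq F] {χ : AddChar F ℂ}

/-- Parseval's identity on `F`. -/
theorem sum_norm_sum_addChar_sq (hχ : χ.IsPrimitive) (c : F → ℂ) :
    ∑ s, ‖∑ i, c i * χ (s * i)‖ ^ 2 = Fintype.card F * ∑ i, ‖c i‖ ^ 2 := by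
  have h : ∀ s, ((‖∑ i, c i * χ (s * i)‖ ^ 2 : ℝ) : ℂ) =
      ∑ i, ∑ j, c i * conj (c j) * χ (s * (i - j)) := by
    intro s
    rw [← Complex.normSq_eq_norm_sq, ← Complex.mul_conj, map_sum, Finset.sum_mul_sum]
    refine Finset.sum_congr rfl fun i _ => Finset.sum_congr rfl fun j _ => ?_
    rw [mul_sub, sub_eq_add_neg, AddChar.map_add_eq_mul, AddChar.map_neg_eq_conj,
      map_mul (starRingEnd ℂ)]
    ring
  apply Complex.ofReal_injective
  rw [Complex.ofReal_sum, Finset.sum_congr rfl fun s _ => h s, Finset.sum_comm]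
  simp only [Finset.sum_comm (s := (Finset.univ : Finset F)) (f := fun s j => _ * χ (s * (_ - j))),
    ← Finset.mul_sum, AddChar.sum_mulShift _ hχ, sub_eq_zero]
  simp [Complex.mul_conj, Complex.normSq_eq_norm_sq, Finset.mul_sum, mul_comm]

omit [DecidableEq F] in
theorem norm_phaseLeft (x : F × F × F) (a i : F) : ‖phaseLeft χ x a i‖ = 1 :=
  AddChar.norm_apply _ _

omit [DecidableEq F] in
theorem norm_phaseRight (x : F × F × F) (a i : F) : ‖phaseRight χ x a i‖ = 1 :=
  AddChar.norm_apply _ _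

theorem sum_phaseLeft_mul_conj (hχ : χ.IsPrimitive) (x : F × F × F) (k l : F) :
    ∑ a, phaseLeft χ x a k * conj (phaseLeft χ x a l) =
      if k = l then (Fintype.card F : ℂ) else 0 := by
  have h : ∀ a, phaseLeft χ x a k * conj (phaseLeft χ x a l) =
      χ (a * (k - l)) * χ (x.1 * (k ^ 2 - l ^ 2)) := by
    intro a
    simp only [phaseLeft]
    rw [← AddChar.map_neg_eq_conj, ← AddChar.map_add_eq_mul, ← AddChar.map_add_eq_mul]
    congr 1; ring
  simp only [h, ← Finset.sum_mul, AddChar.sum_mulShift _ hχ, sub_eq_zero]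
  split_ifs with hkl <;> simp [hkl]

theorem sum_conj_phaseRight_mul (hχ : χ.IsPrimitive) (x : F × F × F) (k l : F) :
    ∑ a, conj (phaseRight χ x a k) * phaseRight χ x a l =
      if k = l then (Fintype.card F : ℂ) else 0 := by
  have h : ∀ a, conj (phaseRight χ x a k) * phaseRight χ x a l =
      χ (a * (l - k)) * χ (x.2.1 * (l - k) + x.2.2 * (l ^ 2 - k ^ 2)) := by
    intro a
    simp only [phaseRight]
    rw [← AddChar.map_neg_eq_conj, ← AddChar.map_add_eq_mul, ← AddChar.map_add_eq_mul]
    congr 1; ring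
  simp only [h, ← Finset.sum_mul, AddChar.sum_mulShift _ hχ, sub_eq_zero, eq_comm (a := l)]
  split_ifs with hkl <;> simp [hkl]

theorem sum_aliceVector_mul_conj (hχ : χ.IsPrimitive) (x : F × F × F) (k l : F ⊕ F) :
    ∑ a, aliceVector χ x a k * conj (aliceVector χ x a l) = if k = l then 1 else 0 := by
  have hq : (Fintype.card F : ℂ) ≠ 0 := Nat.cast_ne_zero.2 Fintype.card_ne_zero
  set r : ℂ := (((Real.sqrt (2 * Fintype.card F))⁻¹ : ℝ) : ℂ) with hr
  have hrr : 2 * (r * r) * Fintype.card F = 1 := by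
    have : (0 : ℝ) ≤ 2 * Fintype.card F := by positivity
    rw [hr, ← Complex.ofReal_mul, ← mul_inv, Real.mul_self_sqrt this]
    push_cast
    field_simp
  rw [Fintype.sum_prod_type]
  simp only [Fin.sum_univ_two]
  rcases k with k | k <;> rcases l with l | l
  · have h := sum_phaseLeft_mul_conj hχ x k l
    simp only [aliceVector, Sum.elim_inl, map_mul, Complex.conj_ofReal, Sum.inl.injEq]
    rw [Finset.sum_congr rfl (g := fun a => 2 * (r * r) *
      (phaseLeft χ x a k * conj (phaseLeft χ x a l))) fun a _ => by push_cast [hr]; simp; ring,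
      ← Finset.mul_sum, h]
    split_ifs
    · exact hrr
    · simp
  · simp [aliceVector]
  · simp [aliceVector]
  · have h := sum_conj_phaseRight_mul hχ x k l
    simp only [aliceVector, Sum.elim_inr, map_mul, Complex.conj_ofReal, Sum.inr.injEq]
    rw [Finset.sum_congr rfl (g := fun a => 2 * (r * r) *
      (conj (phaseRight χ x a k) * phaseRight χ x a l)) fun a _ => by push_cast [hr]; simp; ring,
      ← Finset.mul_sum, h]
    split_ifs
    · exact hrr
    · simp

omit [Fintype F] [DecidableEq F] in
theorem norm_I_pow_mul_addChar [Finite F] (t : ℕ) (c : F) : ‖Complex.I ^ t * χ c‖ = 1 := by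
  simp [AddChar.norm_apply]

theorem sum_bobVector_mul_conj (y : F × F × Fin 2) (k l : F ⊕ F) :
    ∑ b, ∑ i, bobVector χ y b i k * conj (bobVector χ y b i l) = if k = l then 1 else 0 := by
  set r : ℂ := (((Real.sqrt 2)⁻¹ : ℝ) : ℂ) with hr
  have hrr : r * r + r * r = 1 := by
    rw [hr, ← Complex.ofReal_mul, ← mul_inv, Real.mul_self_sqrt (by norm_num)]
    norm_num
  have hr' : ((Real.sqrt 2 : ℂ))⁻¹ = r := by simp [hr]
  have hrc : conj r = r := Complex.conj_ofReal _
  have hu : ∀ i, conj (Complex.I ^ (y.2.2 : ℕ) * χ (y.2.1 * i)) *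
      (Complex.I ^ (y.2.2 : ℕ) * χ (y.2.1 * i)) = 1 := by
    intro i
    rw [← Complex.normSq_eq_conj_mul_self, Complex.normSq_eq_norm_sq, norm_I_pow_mul_addChar]
    simp
  simp only [Fin.sum_univ_two, ← Finset.sum_add_distrib]
  rcases k with k | k <;> rcases l with l | l
  · simp only [bobVector, Sum.elim_inl, hr', Sum.inl.injEq]
    rw [Finset.sum_eq_single k]
    · by_cases h : k = l
      · simp [h, hrc, hrr]
      · simp [h, Ne.symm h]
    · intro i _ hi
      simp [hi.symm]
    · simp
  · simp only [bobVector, Sum.elim_inl, Sum.elim_inr, hr']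
    refine (Finset.sum_eq_zero fun i _ => ?_).trans (by simp)
    split_ifs <;> simp
  · simp only [bobVector, Sum.elim_inl, Sum.elim_inr, hr']
    refine (Finset.sum_eq_zero fun i _ => ?_).trans (by simp)
    split_ifs <;> simp
  · simp only [bobVector, Sum.elim_inr, hr', Sum.inr.injEq]
    rw [Finset.sum_eq_single (k - y.1)]
    · by_cases h : k = l
      · subst h
        have := hu (k - y.1)
        simp only [sub_add_cancel, if_true, outcomeSign_zero, outcomeSign_one, map_mul, hrc,
          Complex.conj_ofReal, Complex.conj_conj] at this ⊢
        push_cast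
        linear_combination 2 * r * r * this + hrr
      · simp [h, Ne.symm h]
    · intro i _ hi
      have : k ≠ i + y.1 := fun h => hi (by rw [h]; ring)
      simp [this]
    · simp

end Values

/-! ### The two values of the functional -/

section Bounds

variable {F : Type} [Field F] [Fintype F] [DecidableEq F] {χ : AddChar F ℂ}

theorem norm_add_mul_conj_sq_sub (u z : ℂ) (σ : ℝ) :
    ‖u + σ * conj z‖ ^ 2 - ‖u + -(σ * conj z)‖ ^ 2 = 4 * (σ * (u * z).re) := by
  simp only [← Complex.normSq_eq_norm_sq, Complex.normSq_apply, Complex.add_re, Complex.add_im,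
    Complex.neg_re, Complex.neg_im, Complex.mul_re, Complex.mul_im, Complex.conj_re,
    Complex.conj_im, Complex.ofReal_re, Complex.ofReal_im]
  ring

/-- The bias of Bob's answer, given Alice's, is proportional to the coefficient. -/
theorem sum_norm_sq_sub_eq_matchingCoeff (x : F × F × F) (y : F × F × Fin 2) (a : F × Fin 2) :
    ∑ i, (‖∑ k, aliceVector χ x a k * bobVector χ y 0 i k‖ ^ 2 -
      ‖∑ k, aliceVector χ x a k * bobVector χ y 1 i k‖ ^ 2) =
      (Fintype.card F : ℝ)⁻¹ * matchingCoeff χ x y a := by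
  set r : ℂ := (((Real.sqrt (2 * Fintype.card F))⁻¹ : ℝ) : ℂ) * (((Real.sqrt 2)⁻¹ : ℝ) : ℂ)
    with hr
  have hrr : ‖r‖ ^ 2 = (4 * Fintype.card F : ℝ)⁻¹ := by
    rw [hr, norm_mul, mul_pow, Complex.norm_real, Complex.norm_real, Real.norm_eq_abs,
      Real.norm_eq_abs, sq_abs, sq_abs, inv_pow, inv_pow, Real.sq_sqrt (by positivity),
      Real.sq_sqrt (by norm_num), ← mul_inv]
    congr 1; ring
  have hk : ∀ b i, ∑ k, aliceVector χ x a k * bobVector χ y b i k =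
      r * (phaseLeft χ x a.1 i + outcomeSign b * (outcomeSign a.2 *
        conj (Complex.I ^ (y.2.2 : ℕ) * χ (y.2.1 * i) * phaseRight χ x a.1 (i + y.1)))) := by
    intro b i
    simp only [Fintype.sum_sum_type, aliceVector, bobVector, Sum.elim_inl, Sum.elim_inr, mul_ite,
      mul_zero, Finset.sum_ite_eq', Finset.mem_univ, if_true, hr, map_mul]
    push_cast
    ring
  have hterm : ∀ i, ‖∑ k, aliceVector χ x a k * bobVector χ y 0 i k‖ ^ 2 -
      ‖∑ k, aliceVector χ x a k * bobVector χ y 1 i k‖ ^ 2 =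
      (Fintype.card F : ℝ)⁻¹ * (outcomeSign a.2 * (Complex.I ^ (y.2.2 : ℕ) *
        (χ (y.2.1 * i) * (phaseLeft χ x a.1 i * phaseRight χ x a.1 (i + y.1)))).re) := by
    intro i
    have := norm_add_mul_conj_sq_sub (phaseLeft χ x a.1 i)
      (Complex.I ^ (y.2.2 : ℕ) * χ (y.2.1 * i) * phaseRight χ x a.1 (i + y.1)) (outcomeSign a.2)
    rw [hk, hk, norm_mul r, norm_mul r, mul_pow, mul_pow, ← mul_sub]
    simp only [outcomeSign_zero, outcomeSign_one, Complex.ofReal_one, Complex.ofReal_neg, one_mul,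
      neg_one_mul]
    rw [this, hrr, mul_inv, show Complex.I ^ (y.2.2 : ℕ) *
      (χ (y.2.1 * i) * (phaseLeft χ x a.1 i * phaseRight χ x a.1 (i + y.1))) =
      phaseLeft χ x a.1 i *
        (Complex.I ^ (y.2.2 : ℕ) * χ (y.2.1 * i) * phaseRight χ x a.1 (i + y.1)) by ring]
    ring
  simp only [hterm, ← Finset.mul_sum, matchingCoeff, matchingSum]
  rw [Finset.mul_sum _ _ (Complex.I ^ _), Complex.re_sum]

theorem sum_norm_matchingSum_sq (hχ : χ.IsPrimitive) (x : F × F × F) (a m : F) :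
    ∑ s, ‖matchingSum χ x a m s‖ ^ 2 = (Fintype.card F : ℝ) ^ 2 := by
  have := sum_norm_sum_addChar_sq hχ fun i => phaseLeft χ x a i * phaseRight χ x a (i + m)
  simp only [mul_comm _ (χ _), norm_mul, norm_phaseLeft, norm_phaseRight] at this
  simp only [matchingSum, this]
  simp [sq]

theorem sum_matchingCoeff_sq (hχ : χ.IsPrimitive) (x : F × F × F) (a : F × Fin 2) :
    ∑ y, matchingCoeff χ x y a * matchingCoeff χ x y a = (Fintype.card F : ℝ) ^ 3 := by
  have h : ∀ y, matchingCoeff χ x y a * matchingCoeff χ x y a =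
      (Complex.I ^ (y.2.2 : ℕ) * matchingSum χ x a.1 y.1 y.2.1).re ^ 2 := by
    intro y
    rw [matchingCoeff, mul_mul_mul_comm, outcomeSign_mul_self, one_mul, sq]
  simp only [h, Fintype.sum_prod_type, Fin.sum_univ_two]
  have h' : ∀ z : ℂ, (Complex.I ^ ((0 : Fin 2) : ℕ) * z).re ^ 2 +
      (Complex.I ^ ((1 : Fin 2) : ℕ) * z).re ^ 2 = ‖z‖ ^ 2 := by
    intro z
    rw [← Complex.normSq_eq_norm_sq, Complex.normSq_apply]
    simp [sq]
  simp only [h', sum_norm_matchingSum_sq hχ]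
  simp; ring

/-- Alice measures in the basis `aliceVector`, Bob in the basis `bobVector`, on the maximally
entangled state of `ℂ^(F ⊕ F)`. -/
theorem pow_five_le_quantumValue {X Y A : Type} [Fintype X] [Fintype Y] [Fintype A]
    [DecidableEq X] [DecidableEq Y] [DecidableEq A] {ιX : F × F × F → X} {ιY : F × F × Fin 2 → Y}
    {ιA : F × Fin 2 → A} (hX : Function.Injective ιX) (hY : Function.Injective ιY)
    (hA : Function.Injective ιA) (hχ : χ.IsPrimitive) :
    (Fintype.card F : ℝ) ^ 5 ≤ quantumValue (biasFunctional ιX ιY ιA (matchingCoeff χ)) := by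
  have hq : (Fintype.card F : ℝ) ≠ 0 := Nat.cast_ne_zero.2 Fintype.card_ne_zero
  refine le_trans (le_of_eq ?_) (sum_le_quantumValue_biasFunctional hX hY hA (matchingCoeff χ)
    (aliceVector χ) (bobVector χ) (sum_aliceVector_mul_conj hχ) sum_bobVector_mul_conj)
  simp only [sum_norm_sq_sub_eq_matchingCoeff]
  have h : ∀ x : F × F × F, ∑ y, ∑ a, matchingCoeff χ x y a *
      ((Fintype.card (F ⊕ F) : ℝ)⁻¹ * ((Fintype.card F : ℝ)⁻¹ * matchingCoeff χ x y a)) =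
      (Fintype.card F : ℝ) ^ 2 := by
    intro x
    rw [Finset.sum_comm]
    simp only [mul_left_comm (matchingCoeff _ _ _ _), ← Finset.mul_sum, sum_matchingCoeff_sq hχ]
    simp
    field_simp
    ring
  simp only [h]
  simp
  ring

/-- For a bias `f` of Bob, the weighted sum of coefficients is a bilinear form in the two blocks
of Alice's phases. -/
theorem exists_sum_matchingCoeff_mul_eq (hχ : χ.IsPrimitive) (f : F × F × Fin 2 → ℝ)
    (hf : ∀ y, |f y| ≤ 1) :
    ∃ C : F → F → ℂ, ∑ i, ∑ j, ‖C i j‖ ^ 2 ≤ 2 * (Fintype.card F : ℝ) ^ 3 ∧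
      ∀ x a, ∑ y, f y * matchingCoeff χ x y a = outcomeSign a.2 *
        (∑ i, ∑ j, C i j * phaseLeft χ x a.1 i * phaseRight χ x a.1 j).re := by
  -- Bob's two inputs `(m, s, 0)` and `(m, s, 1)` form the real and imaginary part of one bias.
  let φ : F → F → ℂ := fun m s => f (m, s, 0) + f (m, s, 1) * Complex.I
  have hφ : ∀ m s, ‖φ m s‖ ^ 2 ≤ 2 := by
    intro m s
    have h0 := (sq_le_one_iff_abs_le_one _).2 (hf (m, s, 0))
    have h1 := (sq_le_one_iff_abs_le_one _).2 (hf (m, s, 1))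
    rw [← Complex.normSq_eq_norm_sq, Complex.normSq_add_mul_I]
    linarith
  refine ⟨fun i j => ∑ s, φ (j - i) s * χ (i * s), ?_, fun x a => ?_⟩
  · have h1 : ∀ i, ∑ j, ‖∑ s, φ (j - i) s * χ (i * s)‖ ^ 2 =
        ∑ m, ‖∑ s, φ m s * χ (i * s)‖ ^ 2 := fun i =>
      Fintype.sum_equiv (Equiv.subRight i) _ _ fun j => rfl
    simp only [h1]
    rw [Finset.sum_comm]
    simp only [sum_norm_sum_addChar_sq hχ, ← Finset.mul_sum]
    calc (Fintype.card F : ℝ) * ∑ m, ∑ s, ‖φ m s‖ ^ 2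
        ≤ Fintype.card F * ∑ m : F, ∑ s : F, (2 : ℝ) := by
          gcongr with m _ s _
          exact hφ m s
      _ = 2 * (Fintype.card F : ℝ) ^ 3 := by simp; ring
  · have h1 : ∀ m s, f (m, s, 0) * matchingCoeff χ x (m, s, 0) a +
        f (m, s, 1) * matchingCoeff χ x (m, s, 1) a =
        outcomeSign a.2 * (φ m s * matchingSum χ x a.1 m s).re := by
      intro m s
      simp [matchingCoeff, φ]
      ring
    simp only [Fintype.sum_prod_type, Fin.sum_univ_two, h1, ← Finset.mul_sum, ← Complex.re_sum]
    congr 2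
    have h2 : ∀ i, ∑ j, (∑ s, φ (j - i) s * χ (i * s)) * phaseLeft χ x a.1 i *
        phaseRight χ x a.1 j = ∑ m, (∑ s, φ m s * χ (i * s)) * phaseLeft χ x a.1 i *
        phaseRight χ x a.1 (i + m) := fun i =>
      Fintype.sum_equiv (Equiv.subRight i) _ _ fun j => by simp
    simp only [h2]
    refine Eq.trans ?_ Finset.sum_comm
    refine Finset.sum_congr rfl fun m _ => ?_
    simp only [matchingSum, Finset.mul_sum, Finset.sum_mul]
    rw [Finset.sum_comm]
    refine Finset.sum_congr rfl fun i _ => Finset.sum_congr rfl fun s _ => ?_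
    rw [mul_comm i s]
    ring

/-- Averaged over Alice's inputs and outputs, the bilinear form has the fourth moment of
independent phases. -/
theorem sum_norm_form_pow_four_le (hχ : χ.IsPrimitive) (h2 : (2 : F) ≠ 0) (C : F → F → ℂ) :
    ∑ x, ∑ a, ‖∑ i, ∑ j, C i j * phaseLeft χ x a i * phaseRight χ x a j‖ ^ 4 ≤
      4 * (Fintype.card F : ℝ) ^ 4 * (∑ i, ∑ j, ‖C i j‖ ^ 2) ^ 2 := by
  refine le_trans (le_of_eq ?_) (sum_norm_bilinear_pow_four_le hχ h2 C)
  rw [Finset.sum_comm]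
  refine Finset.sum_congr rfl fun a _ => ?_
  simp only [Fintype.sum_prod_type]
  refine Finset.sum_congr rfl fun x _ => ?_
  exact Fintype.sum_equiv (Equiv.addLeft a) _ _ fun y => rfl

/-- With `q = Q ^ 4` elements in the field, the classical value is `O(q ^ (19 / 4))`. The maximum
over Alice's outputs of the bilinear form is controlled by the sum of its fourth powers. -/
theorem classicalValue_le {X Y A : Type} [Fintype X] [Fintype Y] [Fintype A]
    [DecidableEq X] [DecidableEq Y] [DecidableEq A] {ιX : F × F × F → X} {ιY : F × F × Fin 2 → Y}
    {ιA : F × Fin 2 → A} (hA : Function.Injective ιA) (hχ : χ.IsPrimitive) (h2 : (2 : F) ≠ 0)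
    {Q : ℝ} (hQ : 0 < Q) (hQq : Q ^ 4 = Fintype.card F) :
    classicalValue (biasFunctional ιX ιY ιA (matchingCoeff χ)) ≤ 33 * Q ^ 19 := by
  refine Real.sSup_le ?_ (by positivity)
  rintro _ ⟨P, hP, rfl⟩
  refine abs_pairing_biasFunctional_le hA (fun p f hp0 hp1 hf => ?_) hP
  obtain ⟨C, hC, hCf⟩ := exists_sum_matchingCoeff_mul_eq hχ f hf
  let T : F × F × F → F → ℂ := fun x a =>
    ∑ i, ∑ j, C i j * phaseLeft χ x a i * phaseRight χ x a j
  have hT : ∀ x a, |∑ y, f y * matchingCoeff χ x y a| ≤ ‖T x a.1‖ := by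
    intro x a
    rw [hCf, abs_mul, abs_outcomeSign, one_mul]
    exact Complex.abs_re_le_norm _
  -- The threshold `Q ^ 7` is the order of magnitude of `‖T x a‖`.
  -- Below it the first summand on the right suffices, above it the second one does.
  have hterm : ∀ x a, p x a * ‖T x a.1‖ ≤ p x a * Q ^ 7 + ‖T x a.1‖ ^ 4 / Q ^ 21 := by
    intro x a
    have hp : p x a ≤ 1 :=
      (Finset.single_le_sum (fun a _ => hp0 x a) (Finset.mem_univ a)).trans (hp1 x)
    rcases le_total ‖T x a.1‖ (Q ^ 7) with h | h
    · have := mul_le_mul_of_nonneg_left h (hp0 x a)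
      have : 0 ≤ ‖T x a.1‖ ^ 4 / Q ^ 21 := by positivity
      linarith
    · have h3 : ‖T x a.1‖ ≤ ‖T x a.1‖ ^ 4 / Q ^ 21 := by
        rw [le_div_iff₀ (by positivity)]
        calc ‖T x a.1‖ * Q ^ 21 = ‖T x a.1‖ * (Q ^ 7) ^ 3 := by ring
          _ ≤ ‖T x a.1‖ * ‖T x a.1‖ ^ 3 := by gcongr
          _ = ‖T x a.1‖ ^ 4 := by ring
      have h4 : p x a * ‖T x a.1‖ ≤ ‖T x a.1‖ := mul_le_of_le_one_left (norm_nonneg _) hp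
      have : 0 ≤ p x a * Q ^ 7 := mul_nonneg (hp0 x a) (by positivity)
      linarith
  have hfour : ∑ x, ∑ a : F × Fin 2, ‖T x a.1‖ ^ 4 ≤ 32 * Q ^ 40 := by
    have h := sum_norm_form_pow_four_le hχ h2 C
    have h' : (∑ i, ∑ j, ‖C i j‖ ^ 2) ^ 2 ≤ (2 * (Fintype.card F : ℝ) ^ 3) ^ 2 :=
      pow_le_pow_left₀ (by positivity) hC 2
    have h'' : ∑ x, ∑ a : F × Fin 2, ‖T x a.1‖ ^ 4 = 2 * ∑ x, ∑ a, ‖T x a‖ ^ 4 := by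
      simp only [Fintype.sum_prod_type, Fin.sum_univ_two, Finset.mul_sum, ← two_mul]
    rw [h'']
    calc 2 * ∑ x, ∑ a, ‖T x a‖ ^ 4
        ≤ 2 * (4 * (Fintype.card F : ℝ) ^ 4 * (2 * (Fintype.card F : ℝ) ^ 3) ^ 2) := by
          refine mul_le_mul_of_nonneg_left (h.trans ?_) (by norm_num)
          gcongr
      _ = 32 * Q ^ 40 := by rw [← hQq]; ring
  calc |∑ x, ∑ y, ∑ a, matchingCoeff χ x y a * (p x a * f y)|
      = |∑ x, ∑ a, p x a * ∑ y, f y * matchingCoeff χ x y a| := by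
        congr 1
        refine Finset.sum_congr rfl fun x _ => ?_
        rw [Finset.sum_comm]
        refine Finset.sum_congr rfl fun a _ => ?_
        rw [Finset.mul_sum]
        exact Finset.sum_congr rfl fun y _ => by ring
    _ ≤ ∑ x, ∑ a, (p x a * Q ^ 7 + ‖T x a.1‖ ^ 4 / Q ^ 21) := by
        simp only [← Real.norm_eq_abs]
        refine norm_sum_le_of_le _ fun x _ => norm_sum_le_of_le _ fun a _ => ?_
        rw [norm_mul, Real.norm_of_nonneg (hp0 x a)]
        exact (mul_le_mul_of_nonneg_left (hT x a) (hp0 x a)).trans (hterm x a)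
    _ = (∑ x, ∑ a, p x a) * Q ^ 7 + (∑ x, ∑ a : F × Fin 2, ‖T x a.1‖ ^ 4) / Q ^ 21 := by
        simp only [Finset.sum_add_distrib, Finset.sum_mul, Finset.sum_div]
    _ ≤ (∑ x : F × F × F, 1) * Q ^ 7 + 32 * Q ^ 40 / Q ^ 21 := by
        gcongr with x
        exact hp1 x
    _ = 33 * Q ^ 19 := by
        simp only [Finset.sum_const, Finset.card_univ, Fintype.card_prod, nsmul_eq_mul]
        push_cast
        rw [← hQq]
        field_simp
        ring

omit [DecidableEq F] in
theorem classicalValue_pos {X Y A : Type} [Fintype X] [Fintype Y] [Fintype A]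
    [DecidableEq X] [DecidableEq Y] [DecidableEq A] {ιX : F × F × F → X} {ιY : F × F × Fin 2 → Y}
    {ιA : F × Fin 2 → A} (hX : Function.Injective ιX) (hY : Function.Injective ιY)
    (hA : Function.Injective ιA) :
    0 < classicalValue (biasFunctional ιX ιY ιA (matchingCoeff χ)) := by
  refine classicalValue_biasFunctional_pos hX hY hA (x₀ := 0) (y₀ := 0) (a₀ := 0) ?_ fun x => ?_
  · simp [matchingCoeff, matchingSum, phaseLeft, phaseRight]
  · simp [Fintype.sum_prod_type, matchingCoeff]

end Bounds

/-! ### The violation -/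

theorem corollary1 :
    ∃ (c : ℕ) (D' : ℝ), 0 < D' ∧ ∀ n : ℕ, 2 ≤ n →
      ∃ F : BellFunctional (Fin (c * n ^ 12)) (Fin (c * n ^ 14)) (Fin (2 * n ^ 2)) (Fin 2),
        D' * (Real.sqrt n / Real.log n) ≤ quantumValue F / classicalValue F := by
  -- `132 = 33 * 4`: the ratio is at least `Q / 33`, where `√n / log n ≤ 4 * Q`.
  refine ⟨1, 1 / 132, by norm_num, fun n hn => ?_⟩
  have hn0 : n ^ 2 / 2 ≠ 0 := by
    have : 2 ^ 2 ≤ n ^ 2 := Nat.pow_le_pow_left hn 2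
    omega
  -- The dimension `2 q` has to be of order `n ^ 2` and to fit into the `2 n ^ 2` outputs.
  obtain ⟨q, hq, hlt, hle⟩ := Nat.exists_prime_lt_and_le_two_mul _ hn0
  have hqn : q ≤ n ^ 2 := hle.trans (Nat.mul_div_le _ _)
  have hnq : n ^ 2 ≤ 2 * q := by omega
  have hq2 : 2 < q := by
    have : 2 ^ 2 ≤ n ^ 2 := Nat.pow_le_pow_left hn 2
    omega
  have : Fact q.Prime := ⟨hq⟩
  have h2 : (2 : ZMod q) ≠ 0 := by
    intro h
    have : ((2 : ℕ) : ZMod q) = 0 := by exact_mod_cast h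
    exact absurd (Nat.le_of_dvd two_pos ((ZMod.natCast_eq_zero_iff _ _).1 this)) (by omega)
  have hn1 : 1 ≤ n := by omega
  obtain ⟨ιX⟩ : Nonempty (ZMod q × ZMod q × ZMod q ↪ Fin (1 * n ^ 12)) := by
    refine Function.Embedding.nonempty_of_card_le ?_
    simp only [Fintype.card_prod, ZMod.card, Fintype.card_fin]
    calc q * (q * q) ≤ n ^ 2 * (n ^ 2 * n ^ 2) := by gcongr
      _ = n ^ 6 := by ring
      _ ≤ n ^ 12 := Nat.pow_le_pow_right hn1 (by norm_num)
      _ = 1 * n ^ 12 := (one_mul _).symm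
  obtain ⟨ιY⟩ : Nonempty (ZMod q × ZMod q × Fin 2 ↪ Fin (1 * n ^ 14)) := by
    refine Function.Embedding.nonempty_of_card_le ?_
    simp only [Fintype.card_prod, ZMod.card, Fintype.card_fin]
    calc q * (q * 2) ≤ n ^ 2 * (n ^ 2 * n) := by gcongr
      _ = n ^ 5 := by ring
      _ ≤ n ^ 14 := Nat.pow_le_pow_right hn1 (by norm_num)
      _ = 1 * n ^ 14 := (one_mul _).symm
  obtain ⟨ιA⟩ : Nonempty (ZMod q × Fin 2 ↪ Fin (2 * n ^ 2)) := by
    refine Function.Embedding.nonempty_of_card_le ?_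
    simp only [Fintype.card_prod, ZMod.card, Fintype.card_fin]
    omega
  have hχ := ZMod.isPrimitive_stdAddChar q
  refine ⟨biasFunctional ιX ιY ιA (matchingCoeff ZMod.stdAddChar), ?_⟩
  set Q : ℝ := Real.sqrt (Real.sqrt q) with hQdef
  have hqpos : (0 : ℝ) < q := by exact_mod_cast hq.pos
  have hQ : 0 < Q := Real.sqrt_pos.2 (Real.sqrt_pos.2 hqpos)
  have hQ2 : Q ^ 2 = Real.sqrt q := Real.sq_sqrt (Real.sqrt_nonneg _)
  have hQ4 : Q ^ 4 = q := by
    rw [show Q ^ 4 = (Q ^ 2) ^ 2 by ring, hQ2, Real.sq_sqrt hqpos.le]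
  have hquantum := pow_five_le_quantumValue ιX.injective ιY.injective ιA.injective hχ
  have hclassical := classicalValue_le (ιX := ιX) (ιY := ιY) ιA.injective hχ h2 hQ
    (by rw [hQ4, ZMod.card])
  have hpos := classicalValue_pos (χ := (ZMod.stdAddChar : AddChar (ZMod q) ℂ)) ιX.injective
    ιY.injective ιA.injective
  rw [ZMod.card, ← hQ4] at hquantum
  have hratio : Q / 33 ≤ quantumValue (biasFunctional ιX ιY ιA (matchingCoeff ZMod.stdAddChar)) /
      classicalValue (biasFunctional ιX ιY ιA (matchingCoeff ZMod.stdAddChar)) := by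
    rw [le_div_iff₀ hpos]
    calc _ ≤ Q / 33 * (33 * Q ^ 19) := by gcongr
      _ = (Q ^ 4) ^ 5 := by ring
      _ ≤ _ := hquantum
  refine le_trans ?_ hratio
  have hsqrt : Real.sqrt n ≤ 2 * Q := by
    refine Real.sqrt_le_iff.2 ⟨by positivity, ?_⟩
    refine (sq_le_sq₀ (Nat.cast_nonneg _) (by positivity)).1 ?_
    have : (n : ℝ) ^ 2 ≤ 2 * q := by exact_mod_cast hnq
    calc (n : ℝ) ^ 2 ≤ 2 * q := this
      _ ≤ 16 * Q ^ 4 := by rw [hQ4]; linarith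
      _ = ((2 * Q) ^ 2) ^ 2 := by ring
  -- The logarithm is not needed for the bound and is estimated from below by a constant.
  have hlog : 1 / 2 ≤ Real.log n := by
    have h1 : Real.log 2 ≤ Real.log n :=
      Real.log_le_log two_pos (by exact_mod_cast hn)
    linarith [Real.log_two_gt_d9]
  have hdiv : Real.sqrt n / Real.log n ≤ 4 * Q := by
    rw [div_le_iff₀ (by linarith)]
    nlinarith
  linarith
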